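/- Let $k$ be a field of characteristic zero and let $V$ be a nonzero finite-dimensional $k$-vector space carrying two Lie algebra structures $\mathfrak{g}=(V,[\,,])$ and $\mathfrak{n}=(V,\{\,,\})$. A post-Lie algebra structure on the pair $(\mathfrak{g},\mathfrak{n})$ is a $k$-bilinear product $V\times V\to V$, $(x,y)\mapsto x\cdot y$, such that for all $x,y,z\in V$ \begin{align*} x\cdot y-y\cdot x&=[x,y]-\{x,y\},\\ [x,y]\cdot z&=x\cdot(y\cdot z)-y\cdot(x\cdot z),\\ x\cdot\{y,z\}&=\{x\cdot y,z\}+\{y,x\cdot z\}. \end{align*} If $\mathfrak{g}$ is perfect, i.e. $[\mathfrak{g},\mathfrak{g}]=\mathfrak{g}$, and $\mathfrak{n}$ is abelian or $2$-step nilpotent (nilpotent of class $2$), then there is no post-Lie algebra structure on $(\mathfrak{g},\mathfrak{n})$. -/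

import Mathlib

/-- A `k`-bilinear Lie bracket on the vector space `V`. Two terms of this type are two Lie algebra
structures with the same underlying vector space. -/
structure LieBracketOn (k V : Type*) [Field k] [AddCommGroup V] [Module k V] where
  /-- The bracket, as a bilinear map. -/
  br : V →ₗ[k] V →ₗ[k] V
  br_self : ∀ x : V, br x x = 0
  jacobi : ∀ x y z : V, br x (br y z) + br y (br z x) + br z (br x y) = 0

namespace LieBracketOn

/-- The Lie algebra `(V, b)`: a copy of `V` which carries the bracket `b`. -/
def Alg {k V : Type*} [Field k] [AddCommGroup V] [Module k V]
    (_b : LieBracketOn k V) : Type _ := V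

theorem br_skew {k V : Type*} [Field k] [AddCommGroup V] [Module k V]
    (b : LieBracketOn k V) (x y : V) : b.br x y = - b.br y x := by
  have h := b.br_self (x + y)
  simp only [map_add, LinearMap.add_apply, b.br_self, zero_add, add_zero] at h
  exact eq_neg_of_add_eq_zero_right h

theorem br_leibniz {k V : Type*} [Field k] [AddCommGroup V] [Module k V]
    (b : LieBracketOn k V) (x y z : V) :
    b.br x (b.br y z) = b.br (b.br x y) z + b.br y (b.br x z) := by
  have h := b.jacobi x y z
  rw [b.br_skew z x, map_neg, b.br_skew z (b.br x y)] at h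
  rw [← sub_eq_zero, ← h]
  abel

variable {k V : Type*} [Field k] [AddCommGroup V] [Module k V] (b : LieBracketOn k V)

instance instAddCommGroupAlg : AddCommGroup b.Alg := inferInstanceAs (AddCommGroup V)

instance instModuleAlg : Module k b.Alg := inferInstanceAs (Module k V)

instance instLieRingAlg : LieRing b.Alg where
  bracket x y := (b.br : V →ₗ[k] V →ₗ[k] V) x y
  add_lie x y z := LinearMap.map_add₂ b.br x y z
  lie_add x y z := map_add (b.br x) y z
  lie_self x := b.br_self x
  leibniz_lie x y z := b.br_leibniz x y z

instance instLieAlgebraAlg : LieAlgebra k b.Alg where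
  lie_smul t x y := map_smul (b.br x) t y

/-- The Lie algebra `(V, b)` is perfect: it equals its derived algebra. -/
def IsPerfect : Prop :=
  ⁅(⊤ : LieIdeal k b.Alg), (⊤ : LieIdeal k b.Alg)⁆ = ⊤

/-- The Lie algebra `(V, b)` is abelian. -/
def IsAbelian : Prop := IsLieAbelian b.Alg

/-- The Lie algebra `(V, b)` is nilpotent of class two. -/
def IsTwoStepNilpotent : Prop :=
  LieRing.IsNilpotent b.Alg ∧ LieModule.nilpotencyLength b.Alg b.Alg = 2

end LieBracketOn

/-- A post-Lie algebra structure on the pair `(𝔤, 𝔫)` of Lie algebras `𝔤 = (V, [ , ])` and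
`𝔫 = (V, { , })` on the same vector space `V`. -/
structure PostLieStructure {k V : Type*} [Field k] [AddCommGroup V] [Module k V]
    (𝔤 𝔫 : LieBracketOn k V) where
  /-- The product `x · y`, as a bilinear map. -/
  mul : V →ₗ[k] V →ₗ[k] V
  /-- `x · y - y · x = [x, y] - {x, y}` -/
  mul_sub_mul : ∀ x y : V, mul x y - mul y x = 𝔤.br x y - 𝔫.br x y
  /-- `[x, y] · z = x · (y · z) - y · (x · z)` -/
  br_mul : ∀ x y z : V, mul (𝔤.br x y) z = mul x (mul y z) - mul y (mul x z)
  /-- `x · {y, z} = {x · y, z} + {y, x · z}` -/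
  mul_br : ∀ x y z : V, mul x (𝔫.br y z) = 𝔫.br (mul x y) z + 𝔫.br y (mul x z)

/-! When `𝔫` has class at most two, `x · y + ½ {x, y}` is a left-symmetric product whose commutator
is `[ , ]`. So `V` is a `𝔤`-module for which the identity is a bijective 1-cocycle, and it suffices
that a nonzero perfect Lie algebra `L` has none.

Two facts about a cocycle `φ : L → M` collide. If `φ` is bijective and `L` perfect, all right
multiplications `R_v` of the product carried to `M` have powers of trace zero, hence no eigenvalue
`-1`, so `φ + ⁅·, v⁆` is injective for every `v` (`eq_zero_of_isOneCocycle_add_lie_eq_zero`). If `L`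
is merely non-solvable and the field algebraically closed, some `φ + ⁅·, v⁆` is not injective
(`IsOneCocycle.exists_ne_zero_add_lie_eq_zero`): induct on dimension, with Whitehead's first lemma
for irreducible quotients. Base change to the algebraic closure finishes. -/

/-! ### Endomorphisms whose powers are traceless -/

open Module LinearMap in
theorem Module.End.eq_zero_of_apply_eq_smul_of_trace_pow_eq_zero {K V : Type*} [Field K] [CharZero K]
    [AddCommGroup V] [Module K V] [FiniteDimensional K V] {f : End K V}
    (hf : ∀ n : ℕ, trace K V (f ^ (n + 1)) = 0) {μ : K} (hμ : μ ≠ 0) {x : V}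
    (hx : f x = μ • x) : x = 0 := by
  open Polynomial in
  by_contra hx0
  have haev (p : K[X]) : aeval f p x = p.eval μ • x :=
    Module.End.aeval_apply_of_mem_apply_eq_smul hx
  obtain ⟨u, hu, hnd⟩ := Polynomial.exists_eq_pow_rootMultiplicity_mul_and_not_dvd f.charpoly
    f.charpoly_monic.ne_zero μ
  set m := rootMultiplicity μ f.charpoly
  have hm : m ≠ 0 := by
    intro hm
    rw [hm, pow_zero, one_mul] at hu
    apply hnd
    rw [dvd_iff_isRoot, ← hu, IsRoot.def]
    have := haev f.charpoly
    rw [LinearMap.aeval_self_charpoly, LinearMap.zero_apply] at this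
    exact (smul_eq_zero.mp this.symm).resolve_right hx0
  -- The Bézout term `b * (X * u)` gives an idempotent in `f`. The factor `X` leaves it no constant
  -- term, so its trace vanishes and in characteristic zero it is zero, yet it fixes `x`.
  have hcop : IsCoprime ((X - C μ) ^ m) (X * u) := by
    apply IsCoprime.pow_left
    rw [(irreducible_X_sub_C μ).coprime_iff_not_dvd, dvd_iff_isRoot, IsRoot.def, eval_mul, eval_X]
    rw [dvd_iff_isRoot, IsRoot.def] at hnd
    exact mul_ne_zero hμ hnd
  obtain ⟨a, b, hab⟩ := hcop
  have hidem : IsIdempotentElem (aeval f (b * (X * u))) := by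
    rw [IsIdempotentElem, ← map_mul, ← sub_eq_zero, ← map_sub]
    have : b * (X * u) * (b * (X * u)) - b * (X * u) = -(a * b * X) * f.charpoly := by
      rw [hu]
      linear_combination (b * (X * u)) * hab
    rw [this, map_mul, LinearMap.aeval_self_charpoly, mul_zero]
  have htr : trace K V (aeval f (b * (X * u))) = 0 := by
    have (q : K[X]) : trace K V (aeval f (q * X)) = 0 := by
      induction q using Polynomial.induction_on' with
      | add p q hp hq => rw [add_mul, map_add, map_add, hp, hq, add_zero]
      | monomial n c =>
        rw [monomial_mul_X, aeval_monomial, ← Algebra.smul_def, map_smul, hf, smul_zero]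
    rw [show b * (X * u) = b * u * X by ring, this]
  have h0 := haev (b * (X * u))
  rw [hidem.eq_zero_of_trace_eq_zero htr, LinearMap.zero_apply] at h0
  have h1 : (b * (X * u)).eval μ = 1 := by
    have := congrArg (eval μ) hab
    rw [eval_add, eval_mul, eval_pow] at this
    simpa [hm] using this
  rw [h1, one_smul] at h0
  exact hx0 h0.symm

/-! ### Bijective cocycles of perfect Lie algebras -/

namespace LieModule

/-- A `1`-cocycle of a Lie algebra with values in a Lie module. -/
def IsOneCocycle {k L M : Type*} [CommRing k] [LieRing L] [LieAlgebra k L] [AddCommGroup M]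
    [Module k M] [LieRingModule L M] (φ : L →ₗ[k] M) : Prop :=
  ∀ x y : L, φ ⁅x, y⁆ = ⁅x, φ y⁆ - ⁅y, φ x⁆

theorem _root_.LinearMap.eq_zero_of_lie_top_eq_top {k L M : Type*} [Field k] [LieRing L]
    [LieAlgebra k L] [AddCommGroup M] [Module k M]
    (hL : ⁅(⊤ : LieIdeal k L), (⊤ : LieIdeal k L)⁆ = ⊤) (f : L →ₗ[k] M)
    (hf : ∀ x y : L, f ⁅x, y⁆ = 0) : f = 0 := by
  have h := LieSubmodule.lieIdeal_oper_eq_linear_span' (R := k) (⊤ : LieIdeal k L)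
    (⊤ : LieIdeal k L)
  rw [hL] at h
  apply LinearMap.ext_on h.symm
  rintro _ ⟨x, -, y, -, rfl⟩
  exact hf x y

variable {k L M : Type*} [Field k] [LieRing L] [LieAlgebra k L]
  [AddCommGroup M] [Module k M] [LieRingModule L M] [LieModule k L M]

theorem trace_toEnd_eq_zero_of_lie_top_eq_top
    (hL : ⁅(⊤ : LieIdeal k L), (⊤ : LieIdeal k L)⁆ = ⊤) (x : L) :
    LinearMap.trace k M (toEnd k L M x) = 0 := by
  have h : ∀ y ∈ (⊤ : LieIdeal k L), LinearMap.trace k M (toEnd k L M y) = 0 := by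
    rw [← hL]
    intro y hy
    rw [← LieSubmodule.mem_toSubmodule, LieSubmodule.lieIdeal_oper_eq_linear_span'] at hy
    induction hy using Submodule.span_induction with
    | mem y hy => obtain ⟨a, -, b, -, rfl⟩ := hy; simp
    | zero => simp
    | add a b _ _ ha hb => simp [ha, hb]
    | smul c a _ ha => simp [ha]
  exact h x (LieSubmodule.mem_top x)

section Bijective

variable (φ : L ≃ₗ[k] M)

/-- The right multiplication by `v` of the product on `M` defined by `u ∘ v = ⁅φ⁻¹ u, v⁆`. -/
def rightMul : M →ₗ[k] M →ₗ[k] M :=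
  ((toEnd k L M : L →ₗ[k] Module.End k M).comp φ.symm.toLinearMap).flip

variable {φ}

@[simp]
theorem rightMul_apply (v u : M) : rightMul φ v u = ⁅φ.symm u, v⁆ := rfl

theorem toEnd_mul_rightMul_sub (hφ : IsOneCocycle (φ : L →ₗ[k] M)) (x : L) (v : M) :
    toEnd k L M x * rightMul φ v - rightMul φ v * toEnd k L M x =
      rightMul φ ⁅x, v⁆ - rightMul φ v * rightMul φ (φ x) := by
  ext u
  have h : ⁅x, φ.symm u⁆ = φ.symm ⁅x, u⁆ - φ.symm ⁅φ.symm u, φ x⁆ := by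
    rw [← map_sub, LinearEquiv.eq_symm_apply]
    simpa using hφ x (φ.symm u)
  simp only [LinearMap.sub_apply, Module.End.mul_apply, toEnd_apply_apply, rightMul_apply]
  have h2 := leibniz_lie x (φ.symm u) v
  rw [h, sub_lie] at h2
  rw [h2]
  abel

/-- The cocycle identity makes `R_{φ x}` the action of `x` minus a conjugate of `ad x`; both are
traceless by perfectness. -/
theorem trace_rightMul_eq_zero (hL : ⁅(⊤ : LieIdeal k L), (⊤ : LieIdeal k L)⁆ = ⊤)
    (hφ : IsOneCocycle (φ : L →ₗ[k] M)) (v : M) : LinearMap.trace k M (rightMul φ v) = 0 := by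
  obtain ⟨x, rfl⟩ := φ.surjective v
  have h : rightMul φ (φ x) = toEnd k L M x - φ.conj (toEnd k L L x) := by
    ext u
    have := hφ x (φ.symm u)
    simp only [LinearEquiv.coe_coe, LinearEquiv.apply_symm_apply] at this
    simp [LinearEquiv.conj_apply, this]
  rw [h, map_sub, LinearMap.trace_conj', trace_toEnd_eq_zero_of_lie_top_eq_top hL,
    trace_toEnd_eq_zero_of_lie_top_eq_top hL, sub_zero]

/-- Multiply `toEnd_mul_rightMul_sub` by `R_v ^ n` and take traces: the commutator side vanishes by
cyclicity. -/
theorem trace_rightMul_mul_pow_succ (hφ : IsOneCocycle (φ : L →ₗ[k] M)) (v w : M) (n : ℕ) :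
    LinearMap.trace k M (rightMul φ w * rightMul φ v ^ (n + 1)) =
      LinearMap.trace k M (rightMul φ (rightMul φ v w) * rightMul φ v ^ n) := by
  obtain ⟨x, rfl⟩ := φ.surjective w
  have h := congrArg (fun f ↦ LinearMap.trace k M (f * rightMul φ v ^ n))
    (toEnd_mul_rightMul_sub hφ x v)
  simp only [sub_mul, map_sub] at h
  have h1 : LinearMap.trace k M (rightMul φ v * toEnd k L M x * rightMul φ v ^ n) =
      LinearMap.trace k M (toEnd k L M x * rightMul φ v * rightMul φ v ^ n) := by
    rw [mul_assoc, LinearMap.trace_mul_comm, mul_assoc, mul_assoc, ← pow_succ, ← pow_succ']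
  have h2 : LinearMap.trace k M (rightMul φ v * rightMul φ (φ x) * rightMul φ v ^ n) =
      LinearMap.trace k M (rightMul φ (φ x) * rightMul φ v ^ (n + 1)) := by
    rw [mul_assoc, LinearMap.trace_mul_comm, mul_assoc, ← pow_succ]
  rw [h1, h2, sub_self] at h
  rw [rightMul_apply, φ.symm_apply_apply]
  exact (sub_eq_zero.mp h.symm).symm

theorem trace_rightMul_pow_succ_eq_zero (hL : ⁅(⊤ : LieIdeal k L), (⊤ : LieIdeal k L)⁆ = ⊤)
    (hφ : IsOneCocycle (φ : L →ₗ[k] M)) (v : M) (n : ℕ) :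
    LinearMap.trace k M (rightMul φ v ^ (n + 1)) = 0 := by
  have h (w : M) : LinearMap.trace k M (rightMul φ w * rightMul φ v ^ n) = 0 := by
    induction n generalizing w with
    | zero => rw [pow_zero, mul_one, trace_rightMul_eq_zero hL hφ]
    | succ n ih => rw [trace_rightMul_mul_pow_succ hφ, ih]
  rw [pow_succ', h]

theorem eq_zero_of_isOneCocycle_add_lie_eq_zero [CharZero k] [FiniteDimensional k M]
    (hL : ⁅(⊤ : LieIdeal k L), (⊤ : LieIdeal k L)⁆ = ⊤)
    (hφ : IsOneCocycle (φ : L →ₗ[k] M)) {v : M} {x : L} (hx : φ x + ⁅x, v⁆ = 0) : x = 0 := by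
  rw [← φ.map_eq_zero_iff]
  -- The hypothesis says `R_v (φ x) = -φ x`.
  apply Module.End.eq_zero_of_apply_eq_smul_of_trace_pow_eq_zero (trace_rightMul_pow_succ_eq_zero hL hφ v)
    (μ := -1) (by simp)
  rw [rightMul_apply, φ.symm_apply_apply, neg_one_smul]
  exact eq_neg_of_add_eq_zero_right hx

end Bijective

end LieModule

/-! ### Casimir element, Whitehead's lemma and Cartan's criterion -/

/-- The invariance of the Casimir tensor of an invariant form. -/
theorem LieAlgebra.sum_lie_dualBasis_eq_zero {k L N ι : Type*} [Field k] [LieRing L]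
    [LieAlgebra k L] [AddCommGroup N] [Module k N] [Fintype ι] [DecidableEq ι]
    {B : LinearMap.BilinForm k L} (hB : B.Nondegenerate) (hsym : B.IsSymm)
    (hinv : ∀ x y z : L, B ⁅x, y⁆ z = - B y ⁅x, z⁆) (b : Module.Basis ι k L)
    (F : L →ₗ[k] L →ₗ[k] N) (y : L) :
    ∑ i, (F ⁅y, b i⁆ (B.dualBasis hB b i) + F (b i) ⁅y, B.dualBasis hB b i⁆) = 0 := by
  set b' := B.dualBasis hB b with hb'
  have h1 (x : L) : x = ∑ j, B x (b' j) • b j := by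
    conv_lhs => rw [← b.sum_repr x]
    congr! with j
    have := LinearMap.BilinForm.dualBasis_repr_apply hB b' x j
    rwa [hb', LinearMap.BilinForm.dualBasis_dualBasis hB hsym] at this
  have h2 (x : L) : x = ∑ j, B x (b j) • b' j := by
    conv_lhs => rw [← b'.sum_repr x]
    simp [hb']
  have e1 (i : ι) : F ⁅y, b i⁆ (b' i) = ∑ j, B ⁅y, b i⁆ (b' j) • F (b j) (b' i) := by
    conv_lhs => rw [h1 ⁅y, b i⁆]
    simp
  have e2 (i : ι) : F (b i) ⁅y, b' i⁆ = ∑ j, B ⁅y, b' i⁆ (b j) • F (b i) (b' j) := by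
    conv_lhs => rw [h2 ⁅y, b' i⁆]
    simp
  simp only [e1, e2]
  rw [Finset.sum_add_distrib]
  conv_lhs => enter [2]; rw [Finset.sum_comm]
  rw [← Finset.sum_add_distrib]
  refine Finset.sum_eq_zero fun i _ ↦ ?_
  rw [← Finset.sum_add_distrib]
  refine Finset.sum_eq_zero fun j _ ↦ ?_
  rw [← add_smul, hinv y (b' j), hsym.eq (b' j), add_neg_cancel, zero_smul]

namespace LieModule

attribute [local instance 100] LieRing.ofAssociativeRing

section

variable {k L M : Type*} [Field k] [CharZero k] [LieRing L] [LieAlgebra k L]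
  [FiniteDimensional k L] [AddCommGroup M] [Module k M] [LieRingModule L M] [LieModule k L M]
  [FiniteDimensional k M]

open Module in
/-- Whitehead's first lemma for an irreducible module with nondegenerate trace form. -/
theorem IsOneCocycle.exists_add_lie_eq_zero_of_nondegenerate [Nontrivial L] [IsIrreducible k L M]
    (hB : (traceForm k L M).Nondegenerate) {φ : L →ₗ[k] M} (hφ : IsOneCocycle φ) :
    ∃ v : M, ∀ x : L, φ x + ⁅x, v⁆ = 0 := by
  let b := finBasis k L
  let b' := (traceForm k L M).dualBasis hB b
  have hinv {N : Type _} [AddCommGroup N] [Module k N] (F : L →ₗ[k] L →ₗ[k] N) :=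
    LieAlgebra.sum_lie_dualBasis_eq_zero hB ⟨traceForm_comm k L M⟩
      (traceForm_apply_lie_apply' k L M) b F
  let C : End k M := ∑ i, toEnd k L M (b i) * toEnd k L M (b' i)
  have hC (y : L) (m : M) : ⁅y, C m⁆ = C ⁅y, m⁆ := by
    have h := congrArg (fun f : End k M ↦ f m) <| hinv
      ((LinearMap.mul k (End k M)).compl₁₂ (toEnd k L M : L →ₗ[k] End k M)
        (toEnd k L M : L →ₗ[k] End k M)) y
    simp only [LinearMap.sum_apply, LinearMap.add_apply, LinearMap.compl₁₂_apply,
      LinearMap.mul_apply', Module.End.mul_apply, LieHom.coe_toLinearMap, toEnd_apply_apply,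
      LinearMap.zero_apply] at h
    rw [← sub_eq_zero, ← h]
    simp only [C, LinearMap.sum_apply, Module.End.mul_apply, toEnd_apply_apply, lie_sum]
    rw [← Finset.sum_sub_distrib]
    refine Finset.sum_congr rfl fun i _ ↦ ?_
    simp only [lie_lie, lie_sub]
    abel
  have htr : LinearMap.trace k M C = finrank k L := by
    have (i : Fin (finrank k L)) : LinearMap.trace k M (toEnd k L M (b i) * toEnd k L M (b' i)) = 1 := by
      have := LinearMap.BilinForm.apply_dualBasis_right hB ⟨traceForm_comm k L M⟩ b i i
      rwa [if_pos rfl, traceForm_apply_apply] at this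
    simp [C, this]
  let N : LieSubmodule k L M :=
    { LinearMap.ker C with
      lie_mem := by
        intro x m hm
        change C ⁅x, m⁆ = 0
        rw [← hC, show C m = 0 from hm, lie_zero] }
  have hN : N = ⊥ := by
    refine (eq_bot_or_eq_top N).resolve_right fun h ↦ ?_
    have : C = 0 := by
      ext m
      exact (h ▸ LieSubmodule.mem_top m : m ∈ N)
    rw [this, map_zero] at htr
    exact (finrank_pos (R := k) (M := L)).ne' (by exact_mod_cast htr.symm)
  have hinj : Function.Injective C := by
    rw [← LinearMap.ker_eq_bot, eq_bot_iff]
    intro m hm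
    have : m ∈ N := hm
    rwa [hN] at this
  -- Invariance of the Casimir tensor under `(x, y) ↦ ⁅x, φ y⁆` gives `C (φ x) = ⁅x, C v⁆` for this
  -- `v`.
  obtain ⟨v, hv⟩ := (LinearMap.injective_iff_surjective.mp hinj) (∑ i, ⁅b i, φ (b' i)⁆)
  refine ⟨-v, fun x ↦ hinj ?_⟩
  have h := hinv ((toEnd k L M : L →ₗ[k] End k M).compl₂ φ) x
  simp only [LinearMap.compl₂_apply, LieHom.coe_toLinearMap, toEnd_apply_apply] at h
  rw [map_add, ← hC, map_neg, hv, lie_neg, map_zero, ← neg_zero, ← h, lie_sum]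
  simp only [C, LinearMap.sum_apply, Module.End.mul_apply, toEnd_apply_apply]
  rw [← sub_eq_add_neg, ← Finset.sum_sub_distrib, ← Finset.sum_neg_distrib]
  refine Finset.sum_congr rfl fun i _ ↦ ?_
  rw [hφ, lie_lie, lie_sub]
  abel

theorem isNilpotent_ad_of_isNilpotent_toEnd {k L M : Type*} [CommRing k] [LieRing L]
    [LieAlgebra k L] [AddCommGroup M] [Module k M] [LieRingModule L M] [LieModule k L M]
    [IsFaithful k L M] {x : L}
    (hx : _root_.IsNilpotent (toEnd k L M x)) : _root_.IsNilpotent (LieAlgebra.ad k L x) := by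
  obtain ⟨n, hn⟩ := LieAlgebra.ad_nilpotent_of_nilpotent (R := k) hx
  refine ⟨n, LinearMap.ext fun y ↦ ?_⟩
  have h (m : ℕ) : toEnd k L M ((LieAlgebra.ad k L x ^ m) y) =
      (LieAlgebra.ad k (Module.End k M) (toEnd k L M x) ^ m) (toEnd k L M y) := by
    induction m with
    | zero => rfl
    | succ m ih => rw [pow_succ', pow_succ', Module.End.mul_apply, Module.End.mul_apply, ← ih,
        LieAlgebra.ad_apply, LieAlgebra.ad_apply, LieHom.map_lie]
  rw [LinearMap.zero_apply, ← toEnd_eq_zero_iff k L M, h, hn, LinearMap.zero_apply]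

variable (k L M) in
/-- A Lie algebra with a faithful representation whose trace form vanishes is solvable. -/
theorem isSolvable_of_traceForm_eq_zero [IsFaithful k L M] (h : traceForm k L M = 0) :
    LieAlgebra.IsSolvable L := by
  have hnil := isNilpotent_derivedSeries_of_traceForm_eq_zero h
  have hfaith : IsFaithful k (LieAlgebra.derivedSeries k L 1) M := by
    rw [isFaithful_iff']
    intro x hx
    exact Subtype.ext ((isFaithful_iff' k L M).mp inferInstance x hx)
  -- Engel's theorem: the derived algebra acts nilpotently and faithfully, so it is ad-nilpotent.
  have : LieRing.IsNilpotent (LieAlgebra.derivedSeries k L 1) := by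
    rw [LieAlgebra.isNilpotent_iff_forall (R := k)]
    exact fun x ↦ isNilpotent_ad_of_isNilpotent_toEnd
      ((isNilpotent_iff_forall' (R := k)).mp hnil x)
  obtain ⟨n, hn⟩ := LieAlgebra.IsSolvable.solvable k (LieAlgebra.derivedSeries k L 1)
  rw [LieIdeal.derivedSeries_eq_bot_iff] at hn
  exact LieAlgebra.IsSolvable.mk (R := k) (k := n + 1)
    (by rw [LieAlgebra.derivedSeries_def, LieAlgebra.derivedSeriesOfIdeal_add]; exact hn)

-- The radical of the form is an ideal on which the trace form vanishes, hence solvable, hence zero.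
variable (k L M) in
theorem traceForm_nondegenerate_of_hasTrivialRadical [IsFaithful k L M]
    [LieAlgebra.HasTrivialRadical k L] : (traceForm k L M).Nondegenerate := by
  refine (traceForm_isSymm k L M).isRefl.nondegenerate_iff_separatingLeft.mpr ?_
  let I : LieIdeal k L :=
    LieAlgebra.InvariantForm.orthogonal _ (traceForm_lieInvariant k L M) ⊤
  have hI (x : L) : x ∈ I ↔ ∀ y, traceForm k L M y x = 0 := by
    simp [I, LieAlgebra.InvariantForm.mem_orthogonal]
  have hfaith : IsFaithful k I M := by
    rw [isFaithful_iff']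
    intro x hx
    exact Subtype.ext ((isFaithful_iff' k L M).mp inferInstance x hx)
  have hsolv : LieAlgebra.IsSolvable I := by
    apply isSolvable_of_traceForm_eq_zero k I M
    ext x y
    exact (hI y).mp y.2 x
  have hbot : I = ⊥ := LieAlgebra.HasTrivialRadical.eq_bot_of_isSolvable I
  intro x hx
  have : x ∈ I := (hI x).mpr fun y ↦ by rw [traceForm_comm, hx]
  rwa [hbot, LieSubmodule.mem_bot] at this

end

/-! ### Cocycles with irreducible coefficients -/

section

variable {k L M : Type*} [Field k] [CharZero k] [IsAlgClosed k] [LieRing L] [LieAlgebra k L]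
  [AddCommGroup M] [Module k M] [LieRingModule L M] [LieModule k L M]
  [FiniteDimensional k M]

/-- For a perfect Lie algebra, a `1`-cocycle with values in an irreducible module which vanishes
on the kernel of the action is a coboundary. -/
theorem IsOneCocycle.exists_add_lie_eq_zero_of_ker_le [IsIrreducible k L M]
    (hL : ⁅(⊤ : LieIdeal k L), (⊤ : LieIdeal k L)⁆ = ⊤) {φ : L →ₗ[k] M} (hφ : IsOneCocycle φ)
    (hker : ∀ x : L, toEnd k L M x = 0 → φ x = 0) :
    ∃ v : M, ∀ x : L, φ x + ⁅x, v⁆ = 0 := by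
  let S := (toEnd k L M).range
  let r : L →ₗ⁅k⁆ S := (toEnd k L M).rangeRestrict
  have hr : Function.Surjective r := LieHom.surjective_rangeRestrict _
  have hrM (x : L) (m : M) : ⁅r x, m⁆ = ⁅x, m⁆ := rfl
  -- `g` is only a linear section; `φ ∘ g` is still a cocycle because `φ` kills the kernel of `r`.
  obtain ⟨g, hg⟩ := (r : L →ₗ[k] S).exists_rightInverse_of_surjective
    (LinearMap.range_eq_top.mpr hr)
  have hrg (s : S) : r (g s) = s := LinearMap.congr_fun hg s
  let ψ : S →ₗ[k] M := φ ∘ₗ g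
  have hψ (x : L) : ψ (r x) = φ x := by
    rw [← sub_eq_zero]
    change φ (g (r x)) - φ x = 0
    rw [← map_sub]
    apply hker
    have : r (g (r x) - x) = 0 := by rw [map_sub, hrg, sub_self]
    exact congrArg Subtype.val this
  have hψc : IsOneCocycle ψ := by
    intro s t
    obtain ⟨x, rfl⟩ := hr s
    obtain ⟨y, rfl⟩ := hr t
    rw [← LieHom.map_lie, hψ, hψ, hψ, hrM, hrM, hφ]
  rcases subsingleton_or_nontrivial S with hS | hS
  · refine ⟨0, fun x ↦ ?_⟩
    rw [lie_zero, add_zero, ← hψ, Subsingleton.elim (r x) 0, map_zero]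
  have : Nontrivial M := nontrivial_of_isIrreducible k L M
  have : IsIrreducible k S M := by
    refine IsIrreducible.mk fun N hN ↦ ?_
    let N' : LieSubmodule k L M :=
      { N.toSubmodule with lie_mem := fun {x m} hm ↦ N.lie_mem (x := r x) hm }
    have hN' : N' ≠ ⊥ := fun h ↦ hN <| by
      rw [LieSubmodule.eq_bot_iff] at h ⊢
      exact h
    have h := (eq_bot_or_eq_top N').resolve_left hN'
    rw [eq_top_iff]
    intro m _
    exact (h ▸ LieSubmodule.mem_top m : m ∈ N')
  -- Over an algebraically closed field the radical acts on `M` by scalars; these are traceless,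
  -- hence zero.
  have : LieAlgebra.HasTrivialRadical k S := by
    refine LieAlgebra.hasTrivialRadical_of_isIrreducible_of_isFaithful k S M fun s ↦ ?_
    obtain ⟨x, rfl⟩ := hr s
    exact trace_toEnd_eq_zero_of_lie_top_eq_top hL x
  obtain ⟨v, hv⟩ := hψc.exists_add_lie_eq_zero_of_nondegenerate
    (traceForm_nondegenerate_of_hasTrivialRadical k S M)
  exact ⟨v, fun x ↦ by rw [← hψ, ← hrM, hv]⟩

/-- For a perfect non-solvable Lie algebra, a `1`-cocycle with values in an irreducible module
becomes zero on a non-solvable subalgebra after adding a coboundary. -/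
theorem IsOneCocycle.exists_not_isSolvable_of_isIrreducible [IsIrreducible k L M]
    (hL : ⁅(⊤ : LieIdeal k L), (⊤ : LieIdeal k L)⁆ = ⊤) (hns : ¬ LieAlgebra.IsSolvable L)
    {φ : L →ₗ[k] M} (hφ : IsOneCocycle φ) :
    ∃ (v : M) (S : LieSubalgebra k L), ¬ LieAlgebra.IsSolvable S ∧
      ∀ x ∈ S, φ x + ⁅x, v⁆ = 0 := by
  by_cases hker : ∀ x : L, toEnd k L M x = 0 → φ x = 0
  · obtain ⟨v, hv⟩ := hφ.exists_add_lie_eq_zero_of_ker_le hL hker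
    refine ⟨v, ⊤, fun h ↦ hns ?_, fun x _ ↦ hv x⟩
    exact (LieAlgebra.solvable_iff_equiv_solvable (LieSubalgebra.topEquiv (R := k) (L := L))).mp h
  push Not at hker
  obtain ⟨a, ha, hφa⟩ := hker
  have ha' (m : M) : ⁅a, m⁆ = 0 := LinearMap.congr_fun ha m
  have hlie {x y : L} (hy : toEnd k L M y = 0) : φ ⁅x, y⁆ = ⁅x, φ y⁆ := by
    rw [hφ, show ⁅y, φ x⁆ = 0 from LinearMap.congr_fun hy _, sub_zero]
  -- The image under `φ` of the kernel of the action is a nonzero submodule, so it is all of `M`.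
  let N : LieSubmodule k L M :=
    { Submodule.map φ (LinearMap.ker (toEnd k L M : L →ₗ[k] Module.End k M)) with
      lie_mem := by
        rintro x _ ⟨y, hy, rfl⟩
        have hy' : toEnd k L M y = 0 := hy
        refine ⟨⁅x, y⁆, ?_, hlie hy'⟩
        change toEnd k L M ⁅x, y⁆ = 0
        rw [LieHom.map_lie, hy', lie_zero] }
  have hN : N = ⊤ := by
    refine (eq_bot_or_eq_top N).resolve_left fun h ↦ hφa ?_
    exact (LieSubmodule.eq_bot_iff N).mp h _ ⟨a, ha, rfl⟩
  let S : LieSubalgebra k L :=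
    { LinearMap.ker φ with
      lie_mem' := by
        intro x y hx hy
        change φ ⁅x, y⁆ = 0
        rw [hφ, show φ x = 0 from hx, show φ y = 0 from hy, lie_zero, lie_zero, sub_zero] }
  refine ⟨0, S, fun hS ↦ ?_, fun x hx ↦ by rw [lie_zero, add_zero]; exact hx⟩
  let R := (toEnd k L M).range
  let r : L →ₗ⁅k⁆ R := (toEnd k L M).rangeRestrict
  have hr : Function.Surjective r := LieHom.surjective_rangeRestrict _
  have hrS : Function.Surjective (r.comp S.incl) := by
    intro s
    obtain ⟨x, rfl⟩ := hr s
    -- Correcting `x` by a `y` that acts trivially moves it into `ker φ` without changing its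
    -- action.
    obtain ⟨y, hy, hyx⟩ : φ x ∈ N := hN ▸ LieSubmodule.mem_top _
    refine ⟨⟨x - y, show φ (x - y) = 0 by rw [map_sub, hyx, sub_self]⟩, Subtype.ext ?_⟩
    change toEnd k L M (x - y) = toEnd k L M x
    rw [map_sub, show toEnd k L M y = 0 from hy, sub_zero]
  have hR : LieAlgebra.IsSolvable R := hrS.lieAlgebra_isSolvable
  -- As a quotient of `L`, the algebra `R` is perfect; being also solvable, it is zero.
  have hRtop : LieAlgebra.derivedSeries k R 1 = ⊤ := by
    rw [← LieIdeal.derivedSeries_map_eq 1 hr, LieAlgebra.derivedSeries_def,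
      LieAlgebra.derivedSeriesOfIdeal_succ, LieAlgebra.derivedSeriesOfIdeal_zero, hL]
    exact LieIdeal.derivedSeries_map_eq 0 hr
  have hRsub : Subsingleton R := by
    by_contra h
    rw [not_subsingleton_iff_nontrivial] at h
    exact (LieAlgebra.derivedSeries_lt_top_of_solvable k R).ne hRtop
  have htriv (x : L) (m : M) : ⁅x, m⁆ = 0 := by
    have : r x = 0 := Subsingleton.elim _ _
    exact LinearMap.congr_fun (congrArg Subtype.val this) m
  apply hφa
  rw [LinearMap.eq_zero_of_lie_top_eq_top hL φ fun x y ↦ by rw [hφ, htriv, htriv, sub_zero],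
    LinearMap.zero_apply]

end

end LieModule

/-! ### Induction on dimension, and descent from the algebraic closure -/

namespace LieAlgebra

theorem isSolvable_of_isSolvable_lie_top {k L : Type*} [CommRing k] [LieRing L] [LieAlgebra k L]
    
    (h : IsSolvable (⁅(⊤ : LieIdeal k L), (⊤ : LieIdeal k L)⁆ : LieIdeal k L)) : IsSolvable L := by
  obtain ⟨n, hn⟩ := IsSolvable.solvable k
    (⁅(⊤ : LieIdeal k L), (⊤ : LieIdeal k L)⁆ : LieIdeal k L)
  rw [LieIdeal.derivedSeries_eq_bot_iff] at hn
  exact IsSolvable.mk (R := k) (k := n + 1)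
    (by rw [derivedSeries_def, derivedSeriesOfIdeal_add]; exact hn)

end LieAlgebra

namespace LieModule

section

variable {k L M : Type*} [CommRing k] [LieRing L] [LieAlgebra k L]
  [AddCommGroup M] [Module k M] [LieRingModule L M] [LieModule k L M]

theorem IsOneCocycle.exists_add_lie {φ : L →ₗ[k] M} (hφ : IsOneCocycle φ) (v : M) :
    ∃ ψ : L →ₗ[k] M, IsOneCocycle ψ ∧ ∀ x, ψ x = φ x + ⁅x, v⁆ := by
  refine ⟨φ + (toEnd k L M : L →ₗ[k] Module.End k M).flip v, fun x y ↦ ?_, fun x ↦ rfl⟩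
  simp only [LinearMap.add_apply, LinearMap.flip_apply, LieHom.coe_toLinearMap,
    toEnd_apply_apply, hφ x y, lie_add, lie_lie]
  abel

theorem isIrreducible_quotient_of_isCoatom {N : LieSubmodule k L M} (hN : IsCoatom N) :
    IsIrreducible k L (M ⧸ N) := by
  have : Nontrivial (M ⧸ N) := by
    refine Submodule.Quotient.nontrivial_iff.mpr ?_
    simpa using hN.1
  refine IsIrreducible.mk fun P hP ↦ ?_
  let q := LieSubmodule.Quotient.mk' N
  have hq : Function.Surjective q := LieSubmodule.Quotient.surjective_mk' N
  have hle : N ≤ P.comap q := fun m hm ↦ by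
    rw [LieSubmodule.mem_comap, (LieSubmodule.Quotient.mk_eq_zero N).mpr hm]
    exact P.zero_mem
  have hne : N ≠ P.comap q := fun h ↦ hP <| by
    rw [LieSubmodule.eq_bot_iff]
    intro p hp
    obtain ⟨m, rfl⟩ := hq p
    exact (LieSubmodule.Quotient.mk_eq_zero N).mpr (h ▸ hp : m ∈ N)
  have htop := hN.2 _ (lt_of_le_of_ne hle hne)
  rw [eq_top_iff]
  intro p _
  obtain ⟨m, rfl⟩ := hq p
  exact (htop ▸ LieSubmodule.mem_top m : m ∈ P.comap q)

end

open Module in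
/-- A `1`-cocycle of a non-solvable Lie algebra becomes non-injective after adding a suitable
coboundary. -/
theorem IsOneCocycle.exists_ne_zero_add_lie_eq_zero {k : Type*} [Field k] [CharZero k]
    [IsAlgClosed k] (n : ℕ) (L M : Type*) [LieRing L] [LieAlgebra k L]
    [FiniteDimensional k L] [AddCommGroup M] [Module k M] [LieRingModule L M] [LieModule k L M]
    [FiniteDimensional k M] (hn : finrank k L + finrank k M = n)
    (hns : ¬ LieAlgebra.IsSolvable L) {φ : L →ₗ[k] M} (hφ : IsOneCocycle φ) :
    ∃ (v : M) (x : L), x ≠ 0 ∧ φ x + ⁅x, v⁆ = 0 := by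
  induction n using Nat.strong_induction_on generalizing L M with
  | _ n ih =>
  -- If `L` is perfect, the shifted cocycle maps a non-solvable subalgebra into a maximal submodule,
  -- which lowers `dim M`; otherwise the derived algebra lowers `dim L`.
  by_cases hL : ⁅(⊤ : LieIdeal k L), (⊤ : LieIdeal k L)⁆ = ⊤
  · rcases subsingleton_or_nontrivial M with hM | hM
    · have : Nontrivial L := by
        by_contra h
        rw [not_nontrivial_iff_subsingleton] at h
        exact hns inferInstance
      obtain ⟨x, hx⟩ := exists_ne (0 : L)
      exact ⟨0, x, hx, Subsingleton.elim _ _⟩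
    · obtain ⟨N, hN, -⟩ := (eq_top_or_exists_le_coatom (⊥ : LieSubmodule k L M)).resolve_left
        bot_ne_top
      have hirr := isIrreducible_quotient_of_isCoatom hN
      let q : M →ₗ⁅k,L⁆ M ⧸ N := LieSubmodule.Quotient.mk' N
      have hq : IsOneCocycle ((q : M →ₗ[k] M ⧸ N) ∘ₗ φ) := by
        intro x y
        simp only [LinearMap.comp_apply, hφ x y, map_sub, LieModuleHom.coe_toLinearMap,
          LieModuleHom.map_lie]
      obtain ⟨w, S, hS, hw⟩ := hq.exists_not_isSolvable_of_isIrreducible hL hns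
      obtain ⟨v, rfl⟩ := LieSubmodule.Quotient.surjective_mk' N w
      obtain ⟨ψ, hψ, hψv⟩ := hφ.exists_add_lie v
      have hψN (x : S) : ψ x ∈ N.toSubmodule := by
        rw [LieSubmodule.mem_toSubmodule, ← LieSubmodule.Quotient.mk_eq_zero, hψv, map_add,
          LieModuleHom.map_lie]
        exact hw x x.2
      let χ : S →ₗ[k] N := (ψ ∘ₗ S.toSubmodule.subtype).codRestrict N.toSubmodule hψN
      have hχ : IsOneCocycle χ := fun x y ↦ Subtype.ext (hψ x y)
      have hlt : finrank k S + finrank k N < n := by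
        have h1 : finrank k S ≤ finrank k L := S.toSubmodule.finrank_le
        have h2 : finrank k N < finrank k M :=
          Submodule.finrank_lt (s := N.toSubmodule) (by simpa using hN.1)
        omega
      obtain ⟨u, x, hx, hux⟩ := ih _ hlt S N rfl hS hχ
      refine ⟨v + u, x, fun h ↦ hx (Subtype.ext h), ?_⟩
      have h := congrArg Subtype.val hux
      rw [lie_add, ← add_assoc, ← hψv]
      exact h
  · let D : LieIdeal k L := ⁅(⊤ : LieIdeal k L), (⊤ : LieIdeal k L)⁆
    have hlt : finrank k D + finrank k M < n := by
      have : finrank k D < finrank k L :=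
        Submodule.finrank_lt (s := D.toSubmodule) (by simpa [D] using hL)
      omega
    let χ : D →ₗ[k] M := φ ∘ₗ D.toSubmodule.subtype
    have hχ : IsOneCocycle χ := fun x y ↦ hφ x y
    obtain ⟨u, x, hx, hux⟩ := ih _ hlt D M rfl
      (fun h ↦ hns (LieAlgebra.isSolvable_of_isSolvable_lie_top (k := k) h)) hχ
    exact ⟨u, x, fun h ↦ hx (Subtype.ext h), hux⟩

theorem IsOneCocycle.subsingleton_of_isAlgClosed {k L M : Type*} [Field k] [CharZero k]
    [IsAlgClosed k] [LieRing L] [LieAlgebra k L] [AddCommGroup M] [Module k M]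
    [LieRingModule L M] [LieModule k L M] [FiniteDimensional k M]
    (hL : ⁅(⊤ : LieIdeal k L), (⊤ : LieIdeal k L)⁆ = ⊤) {φ : L ≃ₗ[k] M}
    (hφ : IsOneCocycle (φ : L →ₗ[k] M)) : Subsingleton L := by
  have : FiniteDimensional k L := φ.symm.finiteDimensional
  by_contra h
  rw [not_subsingleton_iff_nontrivial] at h
  have hns : ¬ LieAlgebra.IsSolvable L := fun _ ↦
    (LieAlgebra.derivedSeries_lt_top_of_solvable k L).ne hL
  obtain ⟨v, x, hx, hvx⟩ := hφ.exists_ne_zero_add_lie_eq_zero _ L M rfl hns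
  exact hx (eq_zero_of_isOneCocycle_add_lie_eq_zero hL hφ hvx)

open scoped TensorProduct in
/-- A nonzero perfect Lie algebra over a field of characteristic zero has no bijective
`1`-cocycle. -/
theorem IsOneCocycle.subsingleton {k L M : Type*} [Field k] [CharZero k]
    [LieRing L] [LieAlgebra k L] [AddCommGroup M] [Module k M]
    [LieRingModule L M] [LieModule k L M] [FiniteDimensional k M]
    (hL : ⁅(⊤ : LieIdeal k L), (⊤ : LieIdeal k L)⁆ = ⊤) {φ : L ≃ₗ[k] M}
    (hφ : IsOneCocycle (φ : L →ₗ[k] M)) : Subsingleton L := by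
  let A := AlgebraicClosure k
  have : CharZero A := charZero_of_injective_algebraMap (algebraMap k A).injective
  let ψ : (A ⊗[k] L) ≃ₗ[A] (A ⊗[k] M) := φ.baseChange k A L M
  have hψt (a : A) (x : L) : ψ (a ⊗ₜ x) = a ⊗ₜ φ x := rfl
  have hψ : IsOneCocycle (ψ : (A ⊗[k] L) →ₗ[A] (A ⊗[k] M)) := by
    intro x y
    simp only [LinearEquiv.coe_coe]
    induction x using TensorProduct.induction_on with
    | zero => simp
    | add x₁ x₂ h₁ h₂ => simp only [add_lie, map_add, h₁, h₂, lie_add]; abel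
    | tmul a x =>
      induction y using TensorProduct.induction_on with
      | zero => simp
      | add y₁ y₂ h₁ h₂ => simp only [add_lie, map_add, h₁, h₂, lie_add]; abel
      | tmul b y =>
        have h := hφ x y
        simp only [LinearEquiv.coe_coe] at h
        simp only [hψt, LieAlgebra.ExtendScalars.bracket_tmul, h, TensorProduct.tmul_sub,
          mul_comm b a]
  have hA : ⁅(⊤ : LieIdeal A (A ⊗[k] L)), (⊤ : LieIdeal A (A ⊗[k] L))⁆ = ⊤ := by
    rw [← LieSubmodule.baseChange_top, ← LieSubmodule.lie_baseChange, hL]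
  have hsub := hψ.subsingleton_of_isAlgClosed hA
  refine ⟨fun x y ↦ ?_⟩
  rw [← sub_eq_zero]
  exact (Module.FaithfullyFlat.one_tmul_eq_zero_iff k L (A := A) (x - y)).mp
    (Subsingleton.elim _ _)

end LieModule

/-! ### From post-Lie structures to bijective cocycles -/

theorem LieBracketOn.br_br_eq_zero {k V : Type*} [Field k] [AddCommGroup V] [Module k V]
    {𝔫 : LieBracketOn k V} (h : 𝔫.IsAbelian ∨ 𝔫.IsTwoStepNilpotent) (x y z : V) :
    𝔫.br x (𝔫.br y z) = 0 := by
  suffices h' : ∀ x y z : 𝔫.Alg, ⁅x, ⁅y, z⁆⁆ = 0 from h' x y z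
  intro x y z
  rcases h with h | ⟨hnil, h⟩
  · have : IsLieAbelian 𝔫.Alg := h
    exact trivial_lie_zero 𝔫.Alg 𝔫.Alg x ⁅y, z⁆
  -- The series starts at index 0 with the whole algebra, so its term of index 2 consists of the
  -- double brackets.
  · have h2 := ((LieModule.nilpotencyLength_eq_succ_iff k 𝔫.Alg 𝔫.Alg 1).mp h).1
    rw [← LieSubmodule.mem_bot (R := k) (L := 𝔫.Alg), ← h2, LieModule.lowerCentralSeries_succ,
      LieModule.lowerCentralSeries_succ, LieModule.lowerCentralSeries_zero]
    exact LieSubmodule.lie_mem_lie (LieSubmodule.mem_top _)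
      (LieSubmodule.lie_mem_lie (LieSubmodule.mem_top _) (LieSubmodule.mem_top _))

namespace PostLieStructure

variable {k V : Type*} [Field k] [CharZero k] [AddCommGroup V] [Module k V]
  {𝔤 𝔫 : LieBracketOn k V}

/-- The product `x · y + ½ {x, y}`, which is left-symmetric when `𝔫` is nilpotent of class at
most two. -/
def leftSymmetricMul (P : PostLieStructure 𝔤 𝔫) : V →ₗ[k] V →ₗ[k] V :=
  P.mul + (2⁻¹ : k) • 𝔫.br

theorem leftSymmetricMul_sub (P : PostLieStructure 𝔤 𝔫) (x y : V) :
    P.leftSymmetricMul x y - P.leftSymmetricMul y x = 𝔤.br x y := by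
  have h := P.mul_sub_mul x y
  rw [sub_eq_iff_eq_add] at h
  simp only [leftSymmetricMul, LinearMap.add_apply, LinearMap.smul_apply, h, 𝔫.br_skew y x]
  module

/-- Left multiplications are derivations of `𝔫`, and double brackets vanish. Any multiple of `{x,
y}` would do here; `½` is forced by `leftSymmetricMul_sub`. -/
theorem leftSymmetricMul_br (P : PostLieStructure 𝔤 𝔫)
    (h : ∀ x y z : V, 𝔫.br x (𝔫.br y z) = 0) (x y z : V) :
    P.leftSymmetricMul (𝔤.br x y) z = P.leftSymmetricMul x (P.leftSymmetricMul y z) -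
      P.leftSymmetricMul y (P.leftSymmetricMul x z) := by
  have hg : 𝔤.br x y = P.mul x y - P.mul y x + 𝔫.br x y := by
    rw [P.mul_sub_mul, sub_add_cancel]
  have h0 : 𝔫.br (𝔫.br x y) z = 0 := by rw [𝔫.br_skew, h, neg_zero]
  have hb : 𝔫.br (𝔤.br x y) z = 𝔫.br (P.mul x y) z - 𝔫.br (P.mul y x) z := by
    rw [hg, map_add, map_sub, LinearMap.add_apply, LinearMap.sub_apply, h0, add_zero]
  simp only [leftSymmetricMul, LinearMap.add_apply, LinearMap.smul_apply, map_add, map_smul,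
    P.br_mul, P.mul_br, hb, h]
  module

end PostLieStructure

theorem mainTheorem12 {k V : Type*} [Field k] [CharZero k] [AddCommGroup V] [Module k V]
    [FiniteDimensional k V] [Nontrivial V] (𝔤 𝔫 : LieBracketOn k V)
    (h𝔤 : 𝔤.IsPerfect) (h𝔫 : 𝔫.IsAbelian ∨ 𝔫.IsTwoStepNilpotent) :
    IsEmpty (PostLieStructure 𝔤 𝔫) := by
  refine ⟨fun P ↦ ?_⟩
  let : LieRingModule 𝔤.Alg V :=
    { bracket := fun x v ↦ P.leftSymmetricMul (x : V) v
      add_lie := fun x y v ↦ LinearMap.map_add₂ P.leftSymmetricMul (x : V) (y : V) v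
      lie_add := fun x v w ↦ map_add (P.leftSymmetricMul (x : V)) v w
      leibniz_lie := fun x y v ↦ by
        have h := P.leftSymmetricMul_br (𝔫.br_br_eq_zero h𝔫) x y v
        exact (sub_eq_iff_eq_add.mp h.symm) }
  let : LieModule k 𝔤.Alg V :=
    { smul_lie := fun t x v ↦ LinearMap.map_smul₂ P.leftSymmetricMul t (x : V) v
      lie_smul := fun t x v ↦ map_smul (P.leftSymmetricMul (x : V)) t v }
  let φ : 𝔤.Alg ≃ₗ[k] V := LinearEquiv.refl k V
  have hφ : LieModule.IsOneCocycle (φ : 𝔤.Alg →ₗ[k] V) := fun x y ↦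
    (P.leftSymmetricMul_sub x y).symm
  have hsub : Subsingleton 𝔤.Alg := hφ.subsingleton h𝔤
  exact not_subsingleton V hsub
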